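/- Let $N \ge 3$ and $2^* = \frac{2N}{N-2}$. Let $\mathcal{D}^{1,2}(\mathbb{R}^N)$ be the completion of $\mathcal{C}_0^\infty(\mathbb{R}^N)$ (real-valued smooth functions with compact support) with respect to the norm $\|u\| = \left(\int_{\mathbb{R}^N} |\nabla u|^2\,dx\right)^{1/2}$; its elements are regarded as functions on $\mathbb{R}^N$ through the continuous map $\mathcal{D}^{1,2}(\mathbb{R}^N) \to L^{2^*}(\mathbb{R}^N)$ extending the identity on $\mathcal{C}_0^\infty(\mathbb{R}^N)$, which exists by the Sobolev inequality. Suppose that the sequence $(u_n) \subset \mathcal{D}^{1,2}(\mathbb{R}^N)$ is bounded and that for some $r > 0$ $$\lim_{n \to \infty} \sup_{y \in \mathbb{R}^N} \int_{B(y,r)} |u_n|^2\,dx = 0.$$ Then, for every continuous $\Psi : \mathbb{R} \to [0,\infty)$ such that $$\lim_{s \to 0} \frac{\Psi(s)}{|s|^{2^*}} = \lim_{|s| \to \infty} \frac{\Psi(s)}{|s|^{2^*}} = 0,$$ each $\Psi(u_n)$ is integrable on $\mathbb{R}^N$ and $$\int_{\mathbb{R}^N} \Psi(u_n)\,dx \to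 0 \quad \text{as } n \to \infty.$$ -/

import Mathlib

open MeasureTheory Filter Topology
open scoped ContDiff

noncomputable section

namespace LionsD12

/-- The Euclidean space `ℝ^N`. -/
abbrev Eu (N : ℕ) : Type := EuclideanSpace ℝ (Fin N)

/-- The critical Sobolev exponent `2^* = 2N/(N-2)`, as a real number (meant for `N ≥ 3`). -/
def critExp (N : ℕ) : ℝ := 2 * (N : ℝ) / ((N : ℝ) - 2)

/-- The critical Sobolev exponent as an extended nonnegative real, to index `L^{2^*}`. -/
abbrev critE (N : ℕ) : ENNReal := ENNReal.ofReal (critExp N)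

theorem one_le_critExp (N : ℕ) (hN : 3 ≤ N) : 1 ≤ critExp N := by
  have h : (3 : ℝ) ≤ N := by exact_mod_cast hN
  rw [critExp, le_div_iff₀ (by linarith)]
  linarith

instance factCrit (N : ℕ) [h : Fact (3 ≤ N)] : Fact ((1 : ENNReal) ≤ critE N) :=
  ⟨by
    rw [← ENNReal.ofReal_one]
    exact ENNReal.ofReal_le_ofReal (one_le_critExp N h.out)⟩

/-- The linear space `C_0^∞(ℝ^N)` of smooth compactly supported real functions. -/
def testSubmodule (N : ℕ) : Submodule ℝ (Eu N → ℝ) where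
  carrier := {φ | ContDiff ℝ ∞ φ ∧ HasCompactSupport φ}
  add_mem' := fun ha hb => ⟨ha.1.add hb.1, ha.2.add hb.2⟩
  zero_mem' := ⟨contDiff_const, HasCompactSupport.zero⟩
  smul_mem' := fun c _ ha => ⟨contDiff_const.smul ha.1, ha.2.smul_left (f := fun _ => c)⟩

/-- `C_0^∞(ℝ^N)` as a type of its own, so that it can carry the Dirichlet norm instead of
the topology of pointwise convergence. -/
def TestFun (N : ℕ) : Type := testSubmodule N

namespace TestFun

variable {N : ℕ}

instance instAddCommGroup : AddCommGroup (TestFun N) :=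
  inferInstanceAs (AddCommGroup (testSubmodule N))

instance instModule : Module ℝ (TestFun N) :=
  inferInstanceAs (Module ℝ (testSubmodule N))

/-- The underlying function of a test function. -/
def fn (φ : TestFun N) : Eu N → ℝ := φ.1

theorem contDiff (φ : TestFun N) : ContDiff ℝ ∞ φ.fn := φ.2.1

theorem hasCompactSupport (φ : TestFun N) : HasCompactSupport φ.fn := φ.2.2

theorem fn_add (φ ψ : TestFun N) : (φ + ψ).fn = φ.fn + ψ.fn := rfl

theorem fn_smul (c : ℝ) (φ : TestFun N) : (c • φ).fn = c • φ.fn := rfl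

theorem differentiable (φ : TestFun N) : Differentiable ℝ φ.fn :=
  φ.contDiff.differentiable (by simp)

theorem memLp (φ : TestFun N) (p : ENNReal) : MemLp φ.fn p volume :=
  φ.contDiff.continuous.memLp_of_hasCompactSupport φ.hasCompactSupport

theorem continuous_gradient (φ : TestFun N) : Continuous (gradient φ.fn) :=
  (InnerProductSpace.toDual ℝ (Eu N)).symm.continuous.comp
    (φ.contDiff.continuous_fderiv (by simp))

theorem memLp_gradient (φ : TestFun N) (p : ENNReal) : MemLp (gradient φ.fn) p volume := by
  refine φ.continuous_gradient.memLp_of_hasCompactSupport ?_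
  exact (φ.hasCompactSupport.fderiv ℝ).comp_left
    (g := (InnerProductSpace.toDual ℝ (Eu N)).symm) (map_zero _)

theorem gradient_add (φ ψ : TestFun N) :
    gradient (φ + ψ).fn = gradient φ.fn + gradient ψ.fn := by
  funext x
  simp only [gradient, fn_add, Pi.add_apply,
    fderiv_add (φ.differentiable x) (ψ.differentiable x), map_add]

theorem gradient_smul (c : ℝ) (φ : TestFun N) :
    gradient (c • φ).fn = c • gradient φ.fn := by
  funext x
  simp only [gradient, fn_smul, Pi.smul_apply, fderiv_const_smul (φ.differentiable x) c]
  simp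

/-- The map `φ ↦ ∇φ` from `C_0^∞(ℝ^N)` to `L²(ℝ^N; ℝ^N)`. -/
def gradL2 (N : ℕ) : TestFun N →ₗ[ℝ] Lp (Eu N) 2 (volume : Measure (Eu N)) where
  toFun φ := (φ.memLp_gradient 2).toLp _
  map_add' φ ψ := by
    rw [← MemLp.toLp_add]
    exact MemLp.toLp_congr _ _ (by rw [gradient_add])
  map_smul' c φ := by
    rw [RingHom.id_apply, ← MemLp.toLp_const_smul]
    exact MemLp.toLp_congr _ _ (by rw [gradient_smul])

/-- The Sobolev inequality on test functions. -/
theorem sobolev (N : ℕ) (hN : 3 ≤ N) : ∃ C : NNReal, ∀ φ : TestFun N,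
    eLpNorm φ.fn (critE N) volume ≤ C * eLpNorm (gradient φ.fn) 2 volume := by
  have h3 : (3 : ℝ) ≤ N := by exact_mod_cast hN
  refine ⟨eLpNormLESNormFDerivOfEqInnerConst (volume : Measure (Eu N)) ((2 : NNReal) : ℝ),
    fun φ => ?_⟩
  have key := eLpNorm_le_eLpNorm_fderiv_of_eq_inner (μ := (volume : Measure (Eu N)))
    (φ.contDiff.of_le (by exact_mod_cast le_top)) φ.hasCompactSupport (p := 2)
    (p' := (critExp N).toNNReal) (by norm_num) (by simp; omega) (by
      rw [Real.coe_toNNReal _ (zero_le_one.trans (one_le_critExp N hN)), critExp]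
      have h1 : (N : ℝ) - 2 ≠ 0 := by linarith
      have h2 : (N : ℝ) ≠ 0 := by linarith
      rw [finrank_euclideanSpace, Fintype.card_fin]
      push_cast
      field_simp)
  refine key.trans (le_of_eq ?_)
  congr 1
  refine eLpNorm_congr_norm_ae (Eventually.of_forall fun x => ?_)
  simp [gradient]

theorem gradL2_injective (N : ℕ) (hN : 3 ≤ N) : Function.Injective (gradL2 N) := by
  rw [injective_iff_map_eq_zero]
  intro φ hφ
  have h0 : gradient φ.fn =ᵐ[volume] 0 := by
    have h := (φ.memLp_gradient 2).coeFn_toLp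
    have h' : (φ.memLp_gradient 2).toLp _ = 0 := hφ
    rw [h'] at h
    exact h.symm.trans (Lp.coeFn_zero _ _ _)
  obtain ⟨C, hC⟩ := sobolev N hN
  have h1 : eLpNorm φ.fn (critE N) volume = 0 := by
    have := hC φ
    rw [eLpNorm_congr_ae h0, eLpNorm_zero, mul_zero] at this
    exact le_antisymm this zero_le
  have hp : critE N ≠ 0 := by
    have := one_le_critExp N hN
    simp only [critE, ne_eq, ENNReal.ofReal_eq_zero, not_le]
    linarith
  rw [eLpNorm_eq_zero_iff φ.contDiff.continuous.aestronglyMeasurable hp] at h1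
  have h2 : φ.fn = 0 :=
    (Continuous.ae_eq_iff_eq volume φ.contDiff.continuous continuous_const).1 h1
  exact Subtype.ext h2

variable [h : Fact (3 ≤ N)]

/-- `C_0^∞(ℝ^N)` with the Dirichlet norm `‖φ‖ = (∫ |∇φ|²)^{1/2}`. -/
instance instNormedAddCommGroup : NormedAddCommGroup (TestFun N) :=
  NormedAddCommGroup.induced _ _ (gradL2 N) (gradL2_injective N h.out)

instance instNormedSpace : NormedSpace ℝ (TestFun N) :=
  NormedSpace.induced ℝ (TestFun N) _ (gradL2 N)

/-- The norm is the Dirichlet norm. -/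
theorem norm_eq (φ : TestFun N) : ‖φ‖ = (∫ x, ‖gradient φ.fn x‖ ^ 2) ^ ((1 : ℝ) / 2) := by
  have h1 : ‖φ‖ = (eLpNorm (gradient φ.fn) 2 volume).toReal :=
    Lp.norm_toLp _ (φ.memLp_gradient 2)
  rw [h1, (φ.memLp_gradient 2).eLpNorm_eq_integral_rpow_norm (by simp) (by simp),
    ENNReal.toReal_ofReal (by positivity)]
  simp

/-- The class in `L^{2^*}` of a test function. -/
def toLpCrit (N : ℕ) [Fact (3 ≤ N)] :
    TestFun N →L[ℝ] Lp ℝ (critE N) (volume : Measure (Eu N)) :=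
  LinearMap.mkContinuousOfExistsBound
    { toFun := fun φ => (φ.memLp (critE N)).toLp φ.fn
      map_add' := fun φ ψ => by
        rw [← MemLp.toLp_add]; rfl
      map_smul' := fun c φ => by
        rw [RingHom.id_apply, ← MemLp.toLp_const_smul]; rfl }
    (by
      obtain ⟨C, hC⟩ := sobolev N (Fact.out : 3 ≤ N)
      refine ⟨C, fun φ => ?_⟩
      have h1 : ‖φ‖ = (eLpNorm (gradient φ.fn) 2 volume).toReal :=
        Lp.norm_toLp _ (φ.memLp_gradient 2)
      rw [h1]
      refine (Lp.norm_toLp _ (φ.memLp (critE N))).trans_le ?_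
      rw [← ENNReal.coe_toReal, ← ENNReal.toReal_mul]
      exact ENNReal.toReal_mono
        (ENNReal.mul_ne_top ENNReal.coe_ne_top (φ.memLp_gradient 2).eLpNorm_ne_top) (hC φ))

end TestFun

/-- `𝒟^{1,2}(ℝ^N)`: the completion of `C_0^∞(ℝ^N)` in the norm `(∫ |∇φ|²)^{1/2}`. -/
abbrev D12 (N : ℕ) [Fact (3 ≤ N)] : Type := UniformSpace.Completion (TestFun N)

/-- The continuous extension of `φ ↦ φ` to a map `𝒟^{1,2}(ℝ^N) → L^{2^*}(ℝ^N)`, through which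
the elements of the completion are functions on `ℝ^N`. -/
def D12.toLp (N : ℕ) [Fact (3 ≤ N)] :
    D12 N →L[ℝ] Lp ℝ (critE N) (volume : Measure (Eu N)) :=
  (TestFun.toLpCrit N).extend (UniformSpace.Completion.toComplL (𝕜 := ℝ) (E := TestFun N))

/-- The function on `ℝ^N` (defined up to null sets) given by an element of `𝒟^{1,2}(ℝ^N)`. -/
def D12.fn {N : ℕ} [Fact (3 ≤ N)] (u : D12 N) : Eu N → ℝ := D12.toLp N u

/-- On a test function, `D12.fn` is the test function itself. -/
theorem D12.fn_coe {N : ℕ} [Fact (3 ≤ N)] (φ : TestFun N) :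
    D12.fn (φ : D12 N) =ᵐ[volume] φ.fn := by
  have h1 : D12.toLp N (φ : D12 N) = TestFun.toLpCrit N φ :=
    ContinuousLinearMap.extend_eq _ UniformSpace.Completion.denseRange_coe
      (UniformSpace.Completion.isUniformInducing_coe _) φ
  rw [D12.fn, h1]
  exact (φ.memLp (critE N)).coeFn_toLp

end LionsD12

end

/-!
The idea is to show that `u n → 0` in measure and that this suffices.

A function `Ψ` that is `o(|s|^{2^*})` at the origin and at infinity satisfies, for every `ε > 0`,
a bound `Ψ s ≤ ε |s|^{2^*} + C · 1_{|s| ≥ δ}` (`exists_le_mul_rpow_add`). The sequence is bounded in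
`L^{2^*}`, so the integral of the first term is `O(ε)` uniformly in `n`, and the integral of the
second is `C` times the measure of `{|u n| ≥ δ}`. That this measure tends to zero is
`tendsto_measure_superlevel`.

An element of `𝒟^{1,2}` need not be square integrable, so one works with `F (u)` where
`F s = s⁴ / (1 + s⁴)`: since `F² ≤ |s|^{2^*}` and `F'` is bounded, `F (u)` is bounded in `H¹`.
By density it is enough to treat test functions `φ`. For a bump function `η` supported in the ball
of radius `r` about the origin, Hölder's inequality at the exponent `q = 2 + 4/N` and the Sobolev
inequality give, for each `y`,
`∫ |η(x - y) F(φ)|^q ≤ (∫_{B(y,r)} |φ|²)^{2/N} · C ∫ |∇(η(x - y) F(φ))|²`.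
The first factor is at most its supremum over `y`; integrating in `y` (instead of summing over
a covering by balls) turns the other two integrals into global ones, and
`∫ F(φ)^q ≤ K (sup_y ∫_{B(y,r)} |φ|²)^{2/N} (∫ |φ|^{2^*} + ∫ |∇φ|²)` follows
(`lintegral_cutPow_le`). Chebyshev's inequality finishes the argument.
-/

open MeasureTheory Filter Topology
open scoped ContDiff ENNReal NNReal

noncomputable section

namespace LionsD12

/-! ### The truncation function -/

/-- The truncation `s ↦ s⁴ / (1 + s⁴)`: a bounded Lipschitz function which vanishes at the origin
fast enough that its square is dominated by `|s|^{2^*}`; this needs `2^* ≤ 8`, while `2^* ≤ 6` for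
`N ≥ 3`. -/
def cutPow (s : ℝ) : ℝ := s ^ 4 / (1 + s ^ 4)

theorem cutPow_nonneg (s : ℝ) : 0 ≤ cutPow s := by unfold cutPow; positivity

theorem cutPow_le_one (s : ℝ) : cutPow s ≤ 1 := by
  unfold cutPow; rw [div_le_one (by positivity)]; linarith

theorem cutPow_le_pow_four (s : ℝ) : cutPow s ≤ |s| ^ 4 := by
  have h : |s| ^ 4 = s ^ 4 := by rw [← abs_pow, abs_of_nonneg (by positivity)]
  rw [h]
  exact div_le_self (by positivity) (by linarith [show 0 ≤ s ^ 4 by positivity])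

theorem cutPow_le_abs (s : ℝ) : cutPow s ≤ |s| := by
  rcases le_total |s| 1 with h | h
  · exact (cutPow_le_pow_four s).trans
      (by simpa using pow_le_pow_of_le_one (abs_nonneg s) h (show 1 ≤ 4 by norm_num))
  · exact (cutPow_le_one s).trans h

theorem cutPow_sq_le_rpow {p : ℝ} (hp0 : 0 ≤ p) (hp : p ≤ 8) (s : ℝ) :
    cutPow s ^ 2 ≤ |s| ^ p := by
  rcases le_total |s| 1 with h | h
  · calc cutPow s ^ 2 ≤ (|s| ^ 4) ^ 2 := by
          gcongr
          · exact cutPow_nonneg s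
          · exact cutPow_le_pow_four s
      _ = |s| ^ (8 : ℝ) := by rw [← pow_mul]; norm_cast
      _ ≤ |s| ^ p := Real.rpow_le_rpow_of_exponent_ge_of_imp (abs_nonneg s) h hp
          (by intro _ h; exact absurd h (by norm_num))
  · calc cutPow s ^ 2 ≤ 1 := pow_le_one₀ (cutPow_nonneg s) (cutPow_le_one s)
      _ ≤ |s| ^ p := Real.one_le_rpow h hp0

theorem contDiff_cutPow : ContDiff ℝ 1 cutPow := by
  unfold cutPow
  exact (contDiff_id.pow 4).div (contDiff_const.add (contDiff_id.pow 4))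
    fun s => by positivity

theorem cutPow_le_cutPow {a s : ℝ} (ha : 0 ≤ a) (h : a ≤ |s|) : cutPow a ≤ cutPow s := by
  have h4 : a ^ 4 ≤ s ^ 4 := by
    have : |s| ^ 4 = s ^ 4 := by rw [← abs_pow, abs_of_nonneg (by positivity)]
    rw [← this]; gcongr
  unfold cutPow
  rw [div_le_div_iff₀ (by positivity) (by positivity)]
  nlinarith

theorem abs_deriv_cutPow_le (s : ℝ) : |deriv cutPow s| ≤ 4 := by
  have hpos : 0 < 1 + s ^ 4 := by positivity
  have h : HasDerivAt cutPow (4 * s ^ 3 / (1 + s ^ 4) ^ 2) s := by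
    have h1 : HasDerivAt (fun s : ℝ => s ^ 4) (4 * s ^ 3) s := by simpa using hasDerivAt_pow 4 s
    exact (h1.div (h1.const_add 1) hpos.ne').congr_deriv (by ring)
  rw [h.deriv, abs_div, abs_of_pos (by positivity : 0 < (1 + s ^ 4) ^ 2),
    div_le_iff₀ (by positivity), abs_mul, abs_pow]
  have h4 : |s| ^ 4 = s ^ 4 := by rw [← abs_pow, abs_of_nonneg (by positivity)]
  rw [← h4, abs_of_pos (by norm_num : (0 : ℝ) < 4)]
  have h0 := abs_nonneg s
  have : |s| ^ 3 ≤ 1 + |s| ^ 4 := by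
    rcases le_total |s| 1 with h | h
    · have := pow_le_one₀ (n := 3) h0 h
      have : 0 ≤ |s| ^ 4 := by positivity
      linarith
    · have := pow_le_pow_right₀ h (show 3 ≤ 4 by norm_num)
      linarith
  nlinarith [show 0 ≤ |s| ^ 4 by positivity]

/-! ### Sobolev inequality and interpolation -/

theorem critExp_pos {N : ℕ} (hN : 3 ≤ N) : 0 < critExp N :=
  zero_lt_one.trans_le (one_le_critExp N hN)

theorem critExp_le_six {N : ℕ} (hN : 3 ≤ N) : critExp N ≤ 6 := by
  have h : (3 : ℝ) ≤ N := by exact_mod_cast hN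
  rw [critExp, div_le_iff₀ (by linarith)]
  linarith

theorem two_le_critExp {N : ℕ} (hN : 3 ≤ N) : 2 ≤ critExp N := by
  have h : (3 : ℝ) ≤ N := by exact_mod_cast hN
  rw [critExp, le_div_iff₀ (by linarith)]
  linarith

theorem critExp_mul {N : ℕ} (hN : 3 ≤ N) : critExp N * (((N : ℝ) - 2) / N) = 2 := by
  have h : (3 : ℝ) ≤ N := by exact_mod_cast hN
  have h1 : (N : ℝ) - 2 ≠ 0 := by linarith
  have h2 : (N : ℝ) ≠ 0 := by linarith
  rw [critExp]; field_simp

theorem lintegral_enorm_sq_eq {α E : Type*} [MeasurableSpace α] [NormedAddCommGroup E]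
    (μ : Measure α) (f : α → E) : ∫⁻ x, ‖f x‖ₑ ^ 2 ∂μ = eLpNorm f 2 μ ^ 2 := by
  rw [eLpNorm_eq_lintegral_rpow_enorm_toReal (by simp) (by simp),
    ← ENNReal.rpow_natCast (_ ^ (1 / _)), ← ENNReal.rpow_mul]
  simp

theorem eLpNorm_critE_eq {N : ℕ} (hN : 3 ≤ N) (f : Eu N → ℝ) :
    eLpNorm f (critE N) volume = (∫⁻ x, ‖f x‖ₑ ^ critExp N) ^ (1 / critExp N) := by
  have hp := critExp_pos hN
  rw [eLpNorm_eq_lintegral_rpow_enorm_toReal (by simpa using hp) (by simp),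
    ENNReal.toReal_ofReal hp.le]

theorem lintegral_rpow_critExp_eq {N : ℕ} (hN : 3 ≤ N) (f : Eu N → ℝ) :
    ∫⁻ x, ‖f x‖ₑ ^ critExp N = eLpNorm f (critE N) volume ^ critExp N := by
  rw [eLpNorm_critE_eq hN, ← ENNReal.rpow_mul, one_div_mul_cancel (critExp_pos hN).ne',
    ENNReal.rpow_one]

/-- The Sobolev inequality in terms of lower Lebesgue integrals, for `C¹` functions: the truncation
of a test function need not be written as a test function. -/
theorem lintegral_sobolev {N : ℕ} (hN : 3 ≤ N) : ∃ C : ℝ≥0, ∀ f : Eu N → ℝ, ContDiff ℝ 1 f →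
    HasCompactSupport f →
    (∫⁻ x, ‖f x‖ₑ ^ critExp N) ^ (((N : ℝ) - 2) / N) ≤ C * ∫⁻ x, ‖fderiv ℝ f x‖ₑ ^ 2 := by
  have h3 : (3 : ℝ) ≤ N := by exact_mod_cast hN
  set C := eLpNormLESNormFDerivOfEqInnerConst (volume : Measure (Eu N)) ((2 : NNReal) : ℝ)
  refine ⟨C ^ 2, fun f hf hc => ?_⟩
  have key := eLpNorm_le_eLpNorm_fderiv_of_eq_inner (μ := (volume : Measure (Eu N)))
    hf hc (p := 2)
    (p' := (critExp N).toNNReal) (by norm_num) (by simp; omega) (by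
      rw [Real.coe_toNNReal _ (zero_le_one.trans (one_le_critExp N hN)), critExp]
      have h1 : (N : ℝ) - 2 ≠ 0 := by linarith
      have h2 : (N : ℝ) ≠ 0 := by linarith
      rw [finrank_euclideanSpace, Fintype.card_fin]
      push_cast
      field_simp)
  have key' : eLpNorm f (critE N) volume ≤ C * eLpNorm (fderiv ℝ f) 2 volume := key
  rw [lintegral_rpow_critExp_eq hN, ← ENNReal.rpow_mul, critExp_mul hN, ENNReal.coe_pow,
    lintegral_enorm_sq_eq, ← mul_pow]
  exact_mod_cast pow_le_pow_left₀ (by simp) key' 2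

/-- Interpolation between `L²` and `L^{2^*}` at the exponent `2 + 4/N`, the one for which the
`L^{2^*}` factor appears as the squared norm `‖f‖²_{2^*}`, so that the Sobolev inequality makes the
right-hand side linear in `∫ |∇f|²`. -/
theorem lintegral_interpolation {N : ℕ} (hN : 3 ≤ N) {f : Eu N → ℝ} (hf : Measurable f) :
    ∫⁻ x, ‖f x‖ₑ ^ (2 + 4 / N : ℝ) ≤
      (∫⁻ x, ‖f x‖ₑ ^ 2) ^ (2 / N : ℝ) *
        (∫⁻ x, ‖f x‖ₑ ^ critExp N) ^ (((N : ℝ) - 2) / N) := by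
  have h3 : (3 : ℝ) ≤ N := by exact_mod_cast hN
  have h := ENNReal.lintegral_mul_norm_pow_le (μ := (volume : Measure (Eu N)))
    (f := fun x => ‖f x‖ₑ ^ 2) (g := fun x => ‖f x‖ₑ ^ critExp N)
    (by fun_prop) (by fun_prop) (p := 2 / N) (q := ((N : ℝ) - 2) / N) (by positivity)
    (div_nonneg (by linarith) (by linarith)) (by field_simp; ring)
  refine le_trans (lintegral_mono fun x => le_of_eq ?_) h
  rw [← ENNReal.rpow_natCast, ← ENNReal.rpow_mul, ← ENNReal.rpow_mul, critExp_mul hN,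
    ← ENNReal.rpow_add_of_nonneg _ _ (by positivity) (by norm_num)]
  congr 1
  push_cast
  ring

/-- Tonelli's theorem and translation invariance; it turns estimates localized around `y` into
global ones by integrating over `y`. -/
theorem lintegral_mul_comp_sub {N : ℕ} {g h : Eu N → ℝ≥0∞} (hg : Measurable g)
    (hh : Measurable h) :
    ∫⁻ y, ∫⁻ x, g (x - y) * h x = (∫⁻ x, g x) * ∫⁻ x, h x := by
  rw [lintegral_lintegral_swap (by fun_prop)]
  have (x : Eu N) : ∫⁻ y, g (x - y) * h x = (∫⁻ y, g y) * h x := by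
    rw [lintegral_mul_const _ (by fun_prop), lintegral_sub_left_eq_self]
  simp_rw [this]
  rw [lintegral_const_mul _ hh]

/-- Hölder's inequality on a ball; the constant does not depend on the centre. -/
theorem lintegral_ball_sq_le {N : ℕ} (hN : 3 ≤ N) (r : ℝ) : ∃ M : ℝ≥0, ∀ f : Eu N → ℝ,
    AEStronglyMeasurable f volume → ∀ y,
      ∫⁻ x in Metric.ball y r, ‖f x‖ₑ ^ 2 ≤ M * eLpNorm f (critE N) volume ^ 2 := by
  have hp := two_le_critExp hN
  set a : ℝ := 1 / (2 : ℝ≥0∞).toReal - 1 / (critE N).toReal with ha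
  have ha0 : 0 ≤ a := by
    rw [ha, ENNReal.toReal_ofReal (by linarith), ENNReal.toReal_ofNat, sub_nonneg]
    exact one_div_le_one_div_of_le (by norm_num) hp
  have htop : (volume (Metric.ball (0 : Eu N) r) ^ a) ^ 2 ≠ ⊤ :=
    ENNReal.pow_ne_top (ENNReal.rpow_ne_top_of_nonneg ha0 measure_ball_lt_top.ne)
  refine ⟨((volume (Metric.ball (0 : Eu N) r) ^ a) ^ 2).toNNReal, fun f hf y => ?_⟩
  rw [ENNReal.coe_toNNReal htop]
  have h2 : (2 : ℝ≥0∞) ≤ critE N := by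
    rw [← ENNReal.ofReal_ofNat]; exact ENNReal.ofReal_le_ofReal hp
  have h := (eLpNorm_le_eLpNorm_mul_rpow_measure_univ h2
    (hf.restrict (s := Metric.ball y r))).trans
      (mul_le_mul_left (eLpNorm_mono_measure f Measure.restrict_le_self) _)
  rw [Measure.restrict_apply_univ, Measure.addHaar_ball_center] at h
  rw [lintegral_enorm_sq_eq, mul_comm, ← mul_pow]
  exact pow_le_pow_left₀ (by simp) h 2

/-! ### The vanishing inequality for test functions -/

/-- The vanishing inequality for truncated test functions. It is obtained by applying the
interpolated Sobolev inequality to `x ↦ η (x - y) F (φ x)`, with `η` a bump function supported in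
the ball of radius `r` and `F = cutPow`, and integrating the result over all `y`. -/
theorem lintegral_cutPow_le {N : ℕ} (hN : 3 ≤ N) {r : ℝ} (hr : 0 < r) :
    ∃ K : ℝ≥0, ∀ φ : TestFun N,
      ∫⁻ x, ‖cutPow (φ.fn x)‖ₑ ^ (2 + 4 / N : ℝ) ≤
        (⨆ y, ∫⁻ x in Metric.ball y r, ‖φ.fn x‖ₑ ^ 2) ^ (2 / N : ℝ) *
          (K * ((∫⁻ x, ‖φ.fn x‖ₑ ^ critExp N) + ∫⁻ x, ‖fderiv ℝ φ.fn x‖ₑ ^ 2)) := by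
  obtain ⟨C, hC⟩ := lintegral_sobolev hN
  let η : ContDiffBump (0 : Eu N) := ⟨r / 2, r, by positivity, by linarith⟩
  have hη1 : ContDiff ℝ 1 η := η.contDiff
  have hηc : HasCompactSupport η := η.hasCompactSupport
  have hηm : Measurable η := hη1.continuous.measurable
  have hη'm : Measurable (fderiv ℝ η) := (hη1.continuous_fderiv (by simp)).measurable
  set q : ℝ := 2 + 4 / N with hq
  have hq0 : 0 < q := by positivity
  have hA : ∫⁻ x, ‖fderiv ℝ η x‖ₑ ^ 2 ≠ ⊤ := by
    rw [lintegral_enorm_sq_eq]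
    exact ENNReal.pow_ne_top ((hη1.continuous_fderiv (by simp)).memLp_of_hasCompactSupport
      (hηc.fderiv ℝ)).eLpNorm_ne_top
  have hB : ∫⁻ x, ‖η x‖ₑ ^ 2 ≠ ⊤ := by
    rw [lintegral_enorm_sq_eq]
    exact ENNReal.pow_ne_top (hη1.continuous.memLp_of_hasCompactSupport hηc).eLpNorm_ne_top
  have hD : ∫⁻ x, ‖η x‖ₑ ^ q ≠ ⊤ := by
    have := (hη1.continuous.memLp_of_hasCompactSupport (μ := volume) (p := ENNReal.ofReal q)
      hηc).eLpNorm_lt_top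
    have := lintegral_rpow_enorm_lt_top_of_eLpNorm_lt_top (by simpa using hq0) (by simp) this
    rw [ENNReal.toReal_ofReal hq0.le] at this
    exact this.ne
  have hD0 : ∫⁻ x, ‖η x‖ₑ ^ q ≠ 0 := by
    intro h0
    have h := (lintegral_eq_zero_iff (by fun_prop)).1 h0
    have h1 : (η : Eu N → ℝ) =ᵐ[volume] fun _ => 0 := by
      filter_upwards [h] with x hx
      simpa [hq0] using hx
    have h2 := (Continuous.ae_eq_iff_eq volume hη1.continuous continuous_const).1 h1
    have h3 := congrFun h2 0
    rw [η.one_of_mem_closedBall (by simp [η.rIn_pos.le])] at h3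
    exact one_ne_zero h3
  set A := ∫⁻ x, ‖fderiv ℝ η x‖ₑ ^ 2
  set B := ∫⁻ x, ‖η x‖ₑ ^ 2
  set D := ∫⁻ x, ‖η x‖ₑ ^ q
  have hKtop : D⁻¹ * (C * (2 * A + 32 * B)) ≠ ⊤ := by
    refine ENNReal.mul_ne_top (ENNReal.inv_ne_top.2 hD0) (ENNReal.mul_ne_top (by simp) ?_)
    exact ENNReal.add_ne_top.2 ⟨ENNReal.mul_ne_top (by simp) hA, ENNReal.mul_ne_top (by simp) hB⟩
  refine ⟨(D⁻¹ * (C * (2 * A + 32 * B))).toNNReal, fun φ => ?_⟩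
  rw [ENNReal.coe_toNNReal hKtop]
  set S := ⨆ y, ∫⁻ x in Metric.ball y r, ‖φ.fn x‖ₑ ^ 2
  have hφ1 : ContDiff ℝ 1 φ.fn := φ.contDiff.of_le (by exact_mod_cast le_top)
  have hFφ : ContDiff ℝ 1 fun x => cutPow (φ.fn x) := contDiff_cutPow.comp hφ1
  have hFm : Measurable fun x => cutPow (φ.fn x) := hFφ.continuous.measurable
  have hφm : Measurable φ.fn := hφ1.continuous.measurable
  have hφ'm : Measurable (fderiv ℝ φ.fn) := (hφ1.continuous_fderiv (by simp)).measurable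
  have hFc : HasCompactSupport fun x => cutPow (φ.fn x) :=
    φ.hasCompactSupport.comp_left (g := cutPow) (by simp [cutPow])
  have hF' (x : Eu N) : ‖fderiv ℝ (fun x => cutPow (φ.fn x)) x‖ ≤ 4 * ‖fderiv ℝ φ.fn x‖ := by
    have h1 : HasFDerivAt (fun x => cutPow (φ.fn x))
        (deriv cutPow (φ.fn x) • fderiv ℝ φ.fn x) x :=
      ((contDiff_cutPow.differentiable (by simp) _).hasDerivAt).comp_hasFDerivAt x
        (hφ1.differentiable (by simp) x).hasFDerivAt
    rw [h1.fderiv, norm_smul]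
    gcongr
    exact abs_deriv_cutPow_le _
  -- the estimate for the function localized around `y`
  have hloc (y : Eu N) : ∫⁻ x, ‖η (x - y)‖ₑ ^ q * ‖cutPow (φ.fn x)‖ₑ ^ q ≤
      S ^ (2 / N : ℝ) * (C * ∫⁻ x, (2 * (‖fderiv ℝ η (x - y)‖ₑ ^ 2 * ‖φ.fn x‖ₑ ^ critExp N) +
        32 * (‖η (x - y)‖ₑ ^ 2 * ‖fderiv ℝ φ.fn x‖ₑ ^ 2))) := by
    set f : Eu N → ℝ := fun x => η (x - y) * cutPow (φ.fn x) with hf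
    have hηy : ContDiff ℝ 1 fun x => η (x - y) := hη1.comp (contDiff_id.sub contDiff_const)
    have hf1 : ContDiff ℝ 1 f := hηy.mul hFφ
    have hfc : HasCompactSupport f := hFc.mul_left
    have h1 := (lintegral_interpolation hN hf1.continuous.measurable).trans
      (mul_le_mul_right (hC f hf1 hfc) _)
    refine le_trans (le_of_eq (lintegral_congr fun x => ?_)) (h1.trans ?_)
    · rw [← ENNReal.mul_rpow_of_nonneg _ _ hq0.le, ← enorm_mul]
    refine mul_le_mul' (ENNReal.rpow_le_rpow ?_ (by positivity)) (mul_le_mul_right ?_ _)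
    · refine le_trans ?_ (le_iSup (fun y => ∫⁻ x in Metric.ball y r, ‖φ.fn x‖ₑ ^ 2) y)
      rw [← lintegral_indicator Metric.isOpen_ball.measurableSet]
      refine lintegral_mono fun x => ?_
      by_cases hx : x ∈ Metric.ball y r
      · rw [Set.indicator_of_mem hx]
        gcongr
        rw [enorm_le_iff_norm_le, hf, norm_mul, Real.norm_of_nonneg η.nonneg,
          Real.norm_of_nonneg (cutPow_nonneg _), Real.norm_eq_abs]
        exact (mul_le_of_le_one_left (cutPow_nonneg _) η.le_one).trans (cutPow_le_abs _)
      · have : η (x - y) = 0 := by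
          refine η.zero_of_le_dist ?_
          rw [dist_zero_right, ← dist_eq_norm]
          simpa using hx
        simp [hf, this]
    · refine lintegral_mono fun x => ?_
      have hd : fderiv ℝ f x = η (x - y) • fderiv ℝ (fun x => cutPow (φ.fn x)) x +
          cutPow (φ.fn x) • fderiv ℝ η (x - y) := by
        rw [hf, fderiv_fun_mul (hηy.differentiable (by simp) x)
          (hFφ.differentiable (by simp) x), fderiv_comp_sub]
      -- the zeroth-order term is bounded by `|φ|^{2^*}`, since `φ` has no `L²` bound
      have hn : ‖fderiv ℝ f x‖ ^ 2 ≤ 2 * (‖fderiv ℝ η (x - y)‖ ^ 2 * ‖φ.fn x‖ ^ critExp N) +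
        32 * (‖η (x - y)‖ ^ 2 * ‖fderiv ℝ φ.fn x‖ ^ 2) := by
        have e1 : ‖fderiv ℝ f x‖ ≤ ‖η (x - y)‖ * (4 * ‖fderiv ℝ φ.fn x‖) +
            cutPow (φ.fn x) * ‖fderiv ℝ η (x - y)‖ := by
          rw [hd]
          refine (norm_add_le _ _).trans ?_
          rw [norm_smul, norm_smul, Real.norm_of_nonneg (cutPow_nonneg _)]
          gcongr
          exact hF' x
        have e2 := cutPow_sq_le_rpow (critExp_pos hN).le
          ((critExp_le_six hN).trans (by norm_num)) (φ.fn x)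
        calc ‖fderiv ℝ f x‖ ^ 2 ≤ _ := pow_le_pow_left₀ (norm_nonneg _) e1 2
          _ ≤ 2 * ((‖η (x - y)‖ * (4 * ‖fderiv ℝ φ.fn x‖)) ^ 2 +
            (cutPow (φ.fn x) * ‖fderiv ℝ η (x - y)‖) ^ 2) := add_sq_le
          _ = 2 * (‖fderiv ℝ η (x - y)‖ ^ 2 * cutPow (φ.fn x) ^ 2) +
            32 * (‖η (x - y)‖ ^ 2 * ‖fderiv ℝ φ.fn x‖ ^ 2) := by ring
          _ ≤ _ := by gcongr; exact e2
      have := ENNReal.ofReal_le_ofReal hn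
      rw [ENNReal.ofReal_add (by positivity) (by positivity), ENNReal.ofReal_mul (by norm_num),
        ENNReal.ofReal_mul (by norm_num), ENNReal.ofReal_mul (by positivity),
        ENNReal.ofReal_mul (by positivity), ENNReal.ofReal_pow (norm_nonneg _),
        ENNReal.ofReal_pow (norm_nonneg _), ENNReal.ofReal_pow (norm_nonneg _),
        ENNReal.ofReal_pow (norm_nonneg _),
        ← ENNReal.ofReal_rpow_of_nonneg (norm_nonneg _) (critExp_pos hN).le] at this
      simpa only [ofReal_norm, ENNReal.ofReal_ofNat] using this
  have hint := lintegral_mono (μ := (volume : Measure (Eu N))) hloc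
  rw [lintegral_mul_comp_sub (g := fun x => ‖η x‖ₑ ^ q)
    (h := fun x => ‖cutPow (φ.fn x)‖ₑ ^ q) (by fun_prop) (by fun_prop)] at hint
  have hmeas : Measurable fun y : Eu N => ∫⁻ x,
      (2 * (‖fderiv ℝ η (x - y)‖ₑ ^ 2 * ‖φ.fn x‖ₑ ^ critExp N) +
        32 * (‖η (x - y)‖ₑ ^ 2 * ‖fderiv ℝ φ.fn x‖ₑ ^ 2)) := by
    refine Measurable.lintegral_prod_right' (f := fun z : Eu N × Eu N =>
      (2 * (‖fderiv ℝ η (z.2 - z.1)‖ₑ ^ 2 * ‖φ.fn z.2‖ₑ ^ critExp N) +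
        32 * (‖η (z.2 - z.1)‖ₑ ^ 2 * ‖fderiv ℝ φ.fn z.2‖ₑ ^ 2))) ?_
    fun_prop
  have hsplit : ∫⁻ y, ∫⁻ x, (2 * (‖fderiv ℝ η (x - y)‖ₑ ^ 2 * ‖φ.fn x‖ₑ ^ critExp N) +
        32 * (‖η (x - y)‖ₑ ^ 2 * ‖fderiv ℝ φ.fn x‖ₑ ^ 2)) =
      2 * (A * ∫⁻ x, ‖φ.fn x‖ₑ ^ critExp N) + 32 * (B * ∫⁻ x, ‖fderiv ℝ φ.fn x‖ₑ ^ 2) := by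
    rw [← lintegral_mul_comp_sub (g := fun x => ‖fderiv ℝ η x‖ₑ ^ 2)
        (h := fun x => ‖φ.fn x‖ₑ ^ critExp N) (by fun_prop) (by fun_prop),
      ← lintegral_mul_comp_sub (g := fun x => ‖η x‖ₑ ^ 2)
        (h := fun x => ‖fderiv ℝ φ.fn x‖ₑ ^ 2) (by fun_prop) (by fun_prop),
      ← lintegral_const_mul _ (Measurable.lintegral_prod_right' (f := fun z : Eu N × Eu N =>
        ‖fderiv ℝ η (z.2 - z.1)‖ₑ ^ 2 * ‖φ.fn z.2‖ₑ ^ critExp N) (by fun_prop)),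
      ← lintegral_const_mul _ (Measurable.lintegral_prod_right' (f := fun z : Eu N × Eu N =>
        ‖η (z.2 - z.1)‖ₑ ^ 2 * ‖fderiv ℝ φ.fn z.2‖ₑ ^ 2) (by fun_prop)),
      ← lintegral_add_left ((Measurable.lintegral_prod_right' (f := fun z : Eu N × Eu N =>
        ‖fderiv ℝ η (z.2 - z.1)‖ₑ ^ 2 * ‖φ.fn z.2‖ₑ ^ critExp N) (by fun_prop)).const_mul _)]
    refine lintegral_congr fun y => ?_
    rw [lintegral_add_left (by fun_prop), lintegral_const_mul _ (by fun_prop),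
      lintegral_const_mul _ (by fun_prop)]
  rw [lintegral_const_mul _ (hmeas.const_mul _), lintegral_const_mul _ hmeas, hsplit] at hint
  calc ∫⁻ x, ‖cutPow (φ.fn x)‖ₑ ^ q
      = D⁻¹ * (D * ∫⁻ x, ‖cutPow (φ.fn x)‖ₑ ^ q) := by
        rw [← mul_assoc, ENNReal.inv_mul_cancel hD0 hD, one_mul]
    _ ≤ D⁻¹ * (S ^ (2 / N : ℝ) * (C * ((2 * A + 32 * B) *
        ((∫⁻ x, ‖φ.fn x‖ₑ ^ critExp N) + ∫⁻ x, ‖fderiv ℝ φ.fn x‖ₑ ^ 2)))) := by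
        refine mul_le_mul_right (hint.trans ?_) _
        gcongr
        rw [add_mul]
        gcongr ?_ + ?_
        · rw [← mul_assoc]; gcongr; exact le_self_add
        · rw [← mul_assoc]; gcongr; exact le_add_self
    _ = _ := by ring

/-! ### Convergence in measure of vanishing sequences -/

theorem D12.eLpNorm_fn {N : ℕ} [Fact (3 ≤ N)] (u : D12 N) :
    eLpNorm u.fn (critE N) volume = ‖D12.toLp N u‖ₑ :=
  (Lp.enorm_def _).symm

theorem D12.aestronglyMeasurable_fn {N : ℕ} [Fact (3 ≤ N)] (u : D12 N) :
    AEStronglyMeasurable u.fn volume :=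
  Lp.aestronglyMeasurable _

theorem D12.fn_sub_coe {N : ℕ} [Fact (3 ≤ N)] (u : D12 N) (φ : TestFun N) :
    D12.fn (u - (φ : D12 N)) =ᵐ[volume] fun x => u.fn x - φ.fn x := by
  have h1 : D12.fn (u - (φ : D12 N)) =ᵐ[volume] D12.fn u - D12.fn (φ : D12 N) := by
    simp only [D12.fn, map_sub]
    exact Lp.coeFn_sub _ _
  filter_upwards [h1, D12.fn_coe φ] with x hx hφ
  rw [hx, Pi.sub_apply, hφ]

theorem TestFun.enorm_eq {N : ℕ} [Fact (3 ≤ N)] (φ : TestFun N) :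
    ‖φ‖ₑ = eLpNorm (gradient φ.fn) 2 volume := by
  rw [← ofReal_norm, show ‖φ‖ = (eLpNorm (gradient φ.fn) 2 volume).toReal from
    Lp.norm_toLp _ (φ.memLp_gradient 2), ENNReal.ofReal_toReal (φ.memLp_gradient 2).eLpNorm_ne_top]

theorem TestFun.lintegral_fderiv_sq {N : ℕ} [Fact (3 ≤ N)] (φ : TestFun N) :
    ∫⁻ x, ‖fderiv ℝ φ.fn x‖ₑ ^ 2 = ‖φ‖ₑ ^ 2 := by
  rw [φ.enorm_eq, ← lintegral_enorm_sq_eq volume]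
  simp [gradient, enorm_eq_nnnorm]

/-- Vanishing of the local `L²` mass of a bounded sequence forces convergence to zero in measure,
which is stated through the superlevel sets. -/
theorem tendsto_measure_superlevel {N : ℕ} [hN : Fact (3 ≤ N)] (u : ℕ → D12 N)
    (hbdd : ∃ C : ℝ, ∀ n, ‖u n‖ ≤ C) {r : ℝ} (hr : 0 < r)
    (hvanish : Tendsto
      (fun n => ⨆ y : Eu N, ∫⁻ x in Metric.ball y r, ‖(u n).fn x‖ₑ ^ 2) atTop (𝓝 0))
    {δ : ℝ} (hδ : 0 < δ) :
    Tendsto (fun n => volume {x | δ ≤ |(u n).fn x|}) atTop (𝓝 0) := by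
  have h3 : 3 ≤ N := hN.out
  have hp := critExp_pos h3
  have hp0 : critE N ≠ 0 := by simpa using hp
  obtain ⟨C, hC⟩ := hbdd
  have happrox (n : ℕ) : ∃ φ : TestFun N, ‖u n - (φ : D12 N)‖ < 1 / ((n : ℝ) + 1) := by
    obtain ⟨φ, hφ⟩ := Metric.denseRange_iff.1
      (UniformSpace.Completion.denseRange_coe (α := TestFun N)) (u n) _
        (Nat.one_div_pos_of_nat (α := ℝ) (n := n))
    exact ⟨φ, by rwa [dist_eq_norm] at hφ⟩
  choose φ hφ using happrox
  have hdiff : Tendsto (fun n => u n - (φ n : D12 N)) atTop (𝓝 0) :=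
    squeeze_zero_norm (fun n => (hφ n).le) tendsto_one_div_add_atTop_nhds_zero_nat
  have hdm (n : ℕ) : AEStronglyMeasurable (fun x => (u n).fn x - (φ n).fn x) volume :=
    (u n).aestronglyMeasurable_fn.sub (φ n).contDiff.continuous.aestronglyMeasurable
  have hdiffLp : Tendsto
      (fun n => eLpNorm (fun x => (u n).fn x - (φ n).fn x) (critE N) volume) atTop (𝓝 0) := by
    have h1 : Tendsto (fun n => ‖D12.toLp N (u n - (φ n : D12 N))‖ₑ) atTop (𝓝 0) := by
      have := (((D12.toLp N).continuous.tendsto 0).comp hdiff).enorm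
      simpa using this
    refine h1.congr fun n => ?_
    rw [← D12.eLpNorm_fn, eLpNorm_congr_ae (D12.fn_sub_coe _ _)]
  have hφbdd (n : ℕ) : ‖φ n‖ ≤ C + 1 := by
    have h1 : ‖(φ n : D12 N)‖ ≤ ‖u n‖ + ‖u n - (φ n : D12 N)‖ := by
      have := norm_sub_le (u n) (u n - (φ n : D12 N))
      rwa [sub_sub_cancel] at this
    rw [UniformSpace.Completion.norm_coe] at h1
    have h2 : 1 / ((n : ℝ) + 1) ≤ 1 := by
      rw [div_le_one (by positivity)]; linarith [(Nat.cast_nonneg n : (0 : ℝ) ≤ n)]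
    linarith [hC n, hφ n]
  -- the approximating test functions vanish locally as well
  have hvanishφ : Tendsto
      (fun n => ⨆ y : Eu N, ∫⁻ x in Metric.ball y r, ‖(φ n).fn x‖ₑ ^ 2) atTop (𝓝 0) := by
    obtain ⟨M, hM⟩ := lintegral_ball_sq_le h3 r
    have hlim : Tendsto (fun n => 2 * (⨆ y : Eu N, ∫⁻ x in Metric.ball y r, ‖(u n).fn x‖ₑ ^ 2) +
        2 * (M * eLpNorm (fun x => (u n).fn x - (φ n).fn x) (critE N) volume ^ 2))
        atTop (𝓝 0) := by
      have h1 := ENNReal.Tendsto.const_mul (a := 2) hvanish (Or.inr (by simp))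
      have h2 := ENNReal.Tendsto.const_mul (a := 2) (ENNReal.Tendsto.const_mul (a := (M : ℝ≥0∞))
        (((ENNReal.continuous_pow 2).tendsto 0).comp hdiffLp) (Or.inr (by simp)))
        (Or.inr (by simp))
      simpa using h1.add h2
    refine tendsto_of_tendsto_of_tendsto_of_le_of_le tendsto_const_nhds hlim
      (fun n => zero_le) fun n => iSup_le fun y => ?_
    have hpt (x : Eu N) : ‖(φ n).fn x‖ₑ ^ 2 ≤
        2 * ‖(u n).fn x‖ₑ ^ 2 + 2 * ‖(u n).fn x - (φ n).fn x‖ₑ ^ 2 := by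
      have hreal : ‖(φ n).fn x‖ ^ 2 ≤
          2 * ‖(u n).fn x‖ ^ 2 + 2 * ‖(u n).fn x - (φ n).fn x‖ ^ 2 := by
        simp only [Real.norm_eq_abs, sq_abs]
        nlinarith [sq_nonneg (2 * (u n).fn x - (φ n).fn x)]
      have := ENNReal.ofReal_le_ofReal hreal
      rw [ENNReal.ofReal_add (by positivity) (by positivity), ENNReal.ofReal_mul (by norm_num),
        ENNReal.ofReal_mul (by norm_num), ENNReal.ofReal_pow (norm_nonneg _),
        ENNReal.ofReal_pow (norm_nonneg _), ENNReal.ofReal_pow (norm_nonneg _)] at this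
      simpa only [ofReal_norm, ENNReal.ofReal_ofNat] using this
    calc ∫⁻ x in Metric.ball y r, ‖(φ n).fn x‖ₑ ^ 2
        ≤ ∫⁻ x in Metric.ball y r,
          (2 * ‖(u n).fn x‖ₑ ^ 2 + 2 * ‖(u n).fn x - (φ n).fn x‖ₑ ^ 2) := lintegral_mono hpt
      _ = 2 * (∫⁻ x in Metric.ball y r, ‖(u n).fn x‖ₑ ^ 2) +
          2 * ∫⁻ x in Metric.ball y r, ‖(u n).fn x - (φ n).fn x‖ₑ ^ 2 := by
        rw [lintegral_add_right' _ (((hdm n).restrict.enorm.pow_const 2).const_mul 2),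
          lintegral_const_mul' _ _ (by simp), lintegral_const_mul' _ _ (by simp)]
      _ ≤ _ := by
        gcongr
        · exact le_iSup (fun y => ∫⁻ x in Metric.ball y r, ‖(u n).fn x‖ₑ ^ 2) y
        · exact hM _ (hdm n) y
  set q : ℝ := 2 + 4 / N with hq
  have hq0 : 0 < q := by positivity
  have hcut : Tendsto (fun n => ∫⁻ x, ‖cutPow ((φ n).fn x)‖ₑ ^ q) atTop (𝓝 0) := by
    obtain ⟨K, hK⟩ := lintegral_cutPow_le h3 hr
    obtain ⟨C', hC'⟩ := TestFun.sobolev N h3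
    set E : ℝ≥0∞ := ENNReal.ofReal (C + 1)
    have hφE (n : ℕ) : ‖φ n‖ₑ ≤ E := by
      rw [← ofReal_norm]; exact ENNReal.ofReal_le_ofReal (hφbdd n)
    have hlim : Tendsto (fun n =>
        (⨆ y : Eu N, ∫⁻ x in Metric.ball y r, ‖(φ n).fn x‖ₑ ^ 2) ^ (2 / N : ℝ) *
          (K * ((C' * E) ^ critExp N + E ^ 2))) atTop (𝓝 0) := by
      have hpos : 0 < (2 / N : ℝ) := by
        have : (3 : ℝ) ≤ N := by exact_mod_cast h3
        positivity
      have h1 := ((ENNReal.continuous_rpow_const (y := (2 / N : ℝ))).tendsto 0).comp hvanishφ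
      rw [ENNReal.zero_rpow_of_pos hpos] at h1
      have htop : (K * ((C' * E) ^ critExp N + E ^ 2) : ℝ≥0∞) ≠ ⊤ :=
        ENNReal.mul_ne_top (by simp) (ENNReal.add_ne_top.2
          ⟨ENNReal.rpow_ne_top_of_nonneg hp.le (ENNReal.mul_ne_top (by simp) (by simp [E])),
            ENNReal.pow_ne_top (by simp [E])⟩)
      simpa using ENNReal.Tendsto.mul_const h1 (Or.inr htop)
    refine tendsto_of_tendsto_of_tendsto_of_le_of_le tendsto_const_nhds hlim
      (fun n => zero_le) fun n => (hK (φ n)).trans ?_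
    rw [lintegral_rpow_critExp_eq h3, TestFun.lintegral_fderiv_sq]
    gcongr
    · refine (hC' (φ n)).trans ?_
      rw [← (φ n).enorm_eq]; gcongr; exact hφE n
    · exact hφE n
  set a := δ / 2 with ha
  have ha0 : 0 < a := by positivity
  have hFa : 0 < cutPow a := by unfold cutPow; positivity
  have hmφ : Tendsto (fun n => volume {x | a ≤ |(φ n).fn x|}) atTop (𝓝 0) := by
    set c : ℝ≥0∞ := ENNReal.ofReal (cutPow a) ^ q
    have hc0 : c ≠ 0 := by simp [c, hFa]
    have hctop : c ≠ ⊤ := ENNReal.rpow_ne_top_of_nonneg hq0.le (by simp)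
    have hlim := ENNReal.Tendsto.div_const (m := _) (b := c) hcut (Or.inr hc0)
    rw [ENNReal.zero_div] at hlim
    refine tendsto_of_tendsto_of_tendsto_of_le_of_le tendsto_const_nhds hlim
      (fun n => zero_le) fun n => ?_
    have hm : Measurable fun x => ‖cutPow ((φ n).fn x)‖ₑ ^ q :=
      ((contDiff_cutPow.continuous.comp (φ n).contDiff.continuous).measurable.enorm).pow_const q
    refine le_trans (measure_mono fun x hx => ?_)
      (meas_ge_le_lintegral_div hm.aemeasurable hc0 hctop)
    refine ENNReal.rpow_le_rpow ?_ hq0.le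
    rw [← ofReal_norm, Real.norm_of_nonneg (cutPow_nonneg _)]
    exact ENNReal.ofReal_le_ofReal (cutPow_le_cutPow ha0.le hx)
  have hmd : Tendsto (fun n => volume {x | a ≤ |(u n).fn x - (φ n).fn x|}) atTop (𝓝 0) := by
    set c : ℝ≥0∞ := ENNReal.ofReal a
    have hc0 : c ≠ 0 := by simp [c, ha0]
    have h1 := ((ENNReal.continuous_rpow_const (y := critExp N)).tendsto 0).comp hdiffLp
    rw [ENNReal.zero_rpow_of_pos hp] at h1
    have hlim := ENNReal.Tendsto.const_mul (a := c⁻¹ ^ critExp N) h1 (Or.inr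
      (ENNReal.rpow_ne_top_of_nonneg hp.le (ENNReal.inv_ne_top.2 hc0)))
    rw [mul_zero] at hlim
    refine tendsto_of_tendsto_of_tendsto_of_le_of_le tendsto_const_nhds hlim
      (fun n => zero_le) fun n => ?_
    have := meas_ge_le_mul_pow_eLpNorm_enorm volume hp0 (by simp) (hdm n) hc0 (by simp [c])
    rw [ENNReal.toReal_ofReal hp.le] at this
    refine le_trans (measure_mono fun x hx => ?_) this
    show ENNReal.ofReal a ≤ _
    rw [← ofReal_norm]
    exact ENNReal.ofReal_le_ofReal hx
  have hsum := hmφ.add hmd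
  rw [add_zero] at hsum
  refine tendsto_of_tendsto_of_tendsto_of_le_of_le tendsto_const_nhds hsum
    (fun n => zero_le) fun n => le_trans (measure_mono fun x hx => ?_) (measure_union_le _ _)
  -- if `δ ≤ |u n x|`, then `|φ n x|` or `|u n x - φ n x|` is at least `δ / 2`
  by_contra hcon
  simp only [Set.mem_union, Set.mem_ofPred_eq, not_or, not_le] at hcon hx
  have := abs_add_le ((u n).fn x - (φ n).fn x) ((φ n).fn x)
  rw [sub_add_cancel] at this
  linarith [hcon.1, hcon.2]

/-! ### Subcritical nonlinearities -/

theorem eq_zero_of_tendsto_div_rpow {p : ℝ} (hp : 0 < p) {Ψ : ℝ → ℝ} (hΨ : Continuous Ψ)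
    (h : Tendsto (fun s => Ψ s / |s| ^ p) (𝓝[≠] 0) (𝓝 0)) : Ψ 0 = 0 := by
  have h1 : Tendsto (fun s : ℝ => |s| ^ p) (𝓝[≠] 0) (𝓝 0) := by
    have h0 : Continuous fun s : ℝ => |s| ^ p := continuous_abs.rpow_const fun _ => Or.inr hp.le
    have := (h0.tendsto 0).mono_left (nhdsWithin_le_nhds (s := {0}ᶜ))
    simpa [Real.zero_rpow hp.ne'] using this
  have h2 := h.mul h1
  rw [zero_mul] at h2
  have h3 : Tendsto Ψ (𝓝[≠] 0) (𝓝 0) := by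
    refine h2.congr' ?_
    filter_upwards [self_mem_nhdsWithin] with s hs
    have : |s| ^ p ≠ 0 := (Real.rpow_pos_of_pos (abs_pos.2 hs) p).ne'
    field_simp
  exact tendsto_nhds_unique ((hΨ.tendsto 0).mono_left nhdsWithin_le_nhds) h3

/-- Up to an error `ε |s|^p`, the function `Ψ` is bounded and lives away from the origin. -/
theorem exists_le_mul_rpow_add {p : ℝ} (hp : 0 < p) {Ψ : ℝ → ℝ} (hΨ : Continuous Ψ)
    (h0 : Tendsto (fun s => Ψ s / |s| ^ p) (𝓝[≠] 0) (𝓝 0))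
    (hinf : Tendsto (fun s => Ψ s / |s| ^ p) (cocompact ℝ) (𝓝 0)) {ε : ℝ} (hε : 0 < ε) :
    ∃ δ > 0, ∃ C : ℝ, 0 ≤ C ∧ ∀ s, Ψ s ≤ ε * |s| ^ p ∨ (δ ≤ |s| ∧ Ψ s ≤ C) := by
  have hle {s : ℝ} (hs : s ≠ 0) (h : Ψ s / |s| ^ p < ε) : Ψ s ≤ ε * |s| ^ p :=
    ((div_lt_iff₀ (Real.rpow_pos_of_pos (abs_pos.2 hs) p)).1 h).le
  obtain ⟨δ, hδ, hδ'⟩ := Metric.mem_nhdsWithin_iff.1 (h0.eventually (gt_mem_nhds hε))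
  obtain ⟨t, ht, hts⟩ := mem_cocompact.1 (hinf.eventually (gt_mem_nhds hε))
  obtain ⟨C, hC⟩ := ht.exists_bound_of_continuousOn hΨ.continuousOn
  refine ⟨δ, hδ, max C 0, le_max_right _ _, fun s => ?_⟩
  rcases eq_or_ne s 0 with rfl | hs
  · left
    rw [eq_zero_of_tendsto_div_rpow hp hΨ h0]
    positivity
  rcases lt_or_ge |s| δ with hsδ | hsδ
  · exact Or.inl (hle hs (hδ' ⟨by simpa using hsδ, hs⟩))
  by_cases hst : s ∈ t
  · exact Or.inr ⟨hsδ, ((le_abs_self _).trans (hC s hst)).trans (le_max_left _ _)⟩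
  · exact Or.inl (hle hs (hts hst))

end LionsD12

end

theorem lemma1p6 (N : ℕ) [Fact (3 ≤ N)] (u : ℕ → LionsD12.D12 N)
    (hbdd : ∃ C : ℝ, ∀ n, ‖u n‖ ≤ C)
    (r : ℝ) (hr : 0 < r)
    (hvanish : Tendsto
      (fun n => ⨆ y : LionsD12.Eu N, ∫⁻ x in Metric.ball y r, ‖(u n).fn x‖ₑ ^ 2) atTop (𝓝 0))
    (Ψ : ℝ → ℝ) (hΨcont : Continuous Ψ) (hΨnonneg : ∀ s, 0 ≤ Ψ s)
    (hΨzero : Tendsto (fun s => Ψ s / |s| ^ LionsD12.critExp N) (𝓝[≠] 0) (𝓝 0))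
    (hΨinfty : Tendsto (fun s => Ψ s / |s| ^ LionsD12.critExp N) (cocompact ℝ) (𝓝 0)) :
    (∀ n, Integrable (fun x => Ψ ((u n).fn x)) volume) ∧
      Tendsto (fun n => ∫ x, Ψ ((u n).fn x)) atTop (𝓝 0) := by
  have h3 : 3 ≤ N := Fact.out
  have hp := LionsD12.critExp_pos h3
  have hmeas (n : ℕ) : AEStronglyMeasurable (fun x => Ψ ((u n).fn x)) volume :=
    hΨcont.comp_aestronglyMeasurable (u n).aestronglyMeasurable_fn
  -- a uniform bound in `L^{2^*}`
  obtain ⟨K, hKtop, hK⟩ : ∃ K : ℝ≥0∞, K ≠ ⊤ ∧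
      ∀ n, ∫⁻ x, ‖(u n).fn x‖ₑ ^ LionsD12.critExp N ≤ K := by
    obtain ⟨C, hC⟩ := hbdd
    refine ⟨ENNReal.ofReal (‖LionsD12.D12.toLp N‖ * C) ^ LionsD12.critExp N,
      ENNReal.rpow_ne_top_of_nonneg hp.le ENNReal.ofReal_ne_top, fun n => ?_⟩
    rw [LionsD12.lintegral_rpow_critExp_eq h3, LionsD12.D12.eLpNorm_fn, ← ofReal_norm]
    refine ENNReal.rpow_le_rpow (ENNReal.ofReal_le_ofReal ?_) hp.le
    exact ((LionsD12.D12.toLp N).le_opNorm _).trans (by gcongr; exact hC n)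
  have h_split (ε : ℝ) (hε : 0 < ε) : ∃ δ > 0, ∃ C : ℝ, ∀ n,
      ∫⁻ x, ENNReal.ofReal (Ψ ((u n).fn x)) ≤ ENNReal.ofReal ε * K +
        ENNReal.ofReal C * volume {x | δ ≤ |(u n).fn x|} := by
    obtain ⟨δ, hδ, C, hC0, hC⟩ :=
      LionsD12.exists_le_mul_rpow_add hp hΨcont hΨzero hΨinfty hε
    refine ⟨δ, hδ, C, fun n => ?_⟩
    have hset : NullMeasurableSet {x | δ ≤ |(u n).fn x|} volume :=
      nullMeasurableSet_le aemeasurable_const (u n).aestronglyMeasurable_fn.norm.aemeasurable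
    calc ∫⁻ x, ENNReal.ofReal (Ψ ((u n).fn x))
        ≤ ∫⁻ x, (ENNReal.ofReal ε * ‖(u n).fn x‖ₑ ^ LionsD12.critExp N +
          {x | δ ≤ |(u n).fn x|}.indicator (fun _ => ENNReal.ofReal C) x) := by
          refine lintegral_mono fun x => ?_
          rcases hC ((u n).fn x) with h | ⟨h, h'⟩
          · refine le_trans ?_ le_self_add
            refine (ENNReal.ofReal_le_ofReal h).trans (le_of_eq ?_)
            rw [ENNReal.ofReal_mul hε.le, ← ENNReal.ofReal_rpow_of_nonneg (abs_nonneg _) hp.le,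
              ← Real.norm_eq_abs, ofReal_norm]
          · refine le_trans ?_ le_add_self
            rw [Set.indicator_of_mem (by exact h)]
            exact ENNReal.ofReal_le_ofReal h'
      _ = ENNReal.ofReal ε * (∫⁻ x, ‖(u n).fn x‖ₑ ^ LionsD12.critExp N) +
          ENNReal.ofReal C * volume {x | δ ≤ |(u n).fn x|} := by
          rw [lintegral_add_left'
              (((u n).aestronglyMeasurable_fn.enorm.pow_const _).const_mul _),
            lintegral_const_mul' _ _ ENNReal.ofReal_ne_top, lintegral_indicator_const₀ hset]
      _ ≤ _ := by gcongr; exact hK n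
  -- the superlevel sets have finite measure by Chebyshev's inequality in `L^{2^*}`
  have hfin (n : ℕ) : ∫⁻ x, ENNReal.ofReal (Ψ ((u n).fn x)) < ⊤ := by
    obtain ⟨δ, hδ, C, hC⟩ := h_split 1 one_pos
    refine (hC n).trans_lt (ENNReal.add_lt_top.2 ⟨ENNReal.mul_lt_top (by simp) hKtop.lt_top,
      ENNReal.mul_lt_top (by simp) ?_⟩)
    have hc : ENNReal.ofReal δ ^ LionsD12.critExp N ≠ 0 := by simp [hδ]
    have hm := meas_ge_le_lintegral_div
      ((u n).aestronglyMeasurable_fn.enorm.pow_const (LionsD12.critExp N)) hc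
      (ENNReal.rpow_ne_top_of_nonneg hp.le (by simp))
    refine (measure_mono fun x hx => ?_).trans_lt
      (hm.trans_lt (ENNReal.div_lt_top ((hK n).trans_lt hKtop.lt_top).ne hc))
    refine ENNReal.rpow_le_rpow ?_ hp.le
    rw [← ofReal_norm]
    exact ENNReal.ofReal_le_ofReal hx
  -- choose `ε` so that the critical term is small uniformly in `n`, then let `n → ∞`
  have hlim : Tendsto (fun n => ∫⁻ x, ENNReal.ofReal (Ψ ((u n).fn x))) atTop (𝓝 0) := by
    rw [ENNReal.tendsto_nhds_zero]
    intro η hη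
    obtain ⟨ε, hε, hεK⟩ : ∃ ε : ℝ, 0 < ε ∧ ENNReal.ofReal ε * K ≤ η / 2 := by
      have h1 : Tendsto (fun ε : ℝ => ENNReal.ofReal ε * K) (𝓝[>] 0) (𝓝 0) := by
        have := ENNReal.Tendsto.mul_const (b := K)
          ((ENNReal.continuous_ofReal.tendsto 0).mono_left (nhdsWithin_le_nhds (s := Set.Ioi 0)))
          (Or.inr hKtop)
        simpa using this
      have h2 := (h1.eventually (Iic_mem_nhds (ENNReal.half_pos hη.ne'))).and
        self_mem_nhdsWithin
      obtain ⟨ε, h, h'⟩ := h2.exists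
      exact ⟨ε, h', h⟩
    obtain ⟨δ, hδ, C, hC⟩ := h_split ε hε
    have h1 := ENNReal.Tendsto.const_mul (a := ENNReal.ofReal C)
      (LionsD12.tendsto_measure_superlevel u hbdd hr hvanish hδ) (Or.inr (by simp))
    rw [mul_zero] at h1
    filter_upwards [h1.eventually (Iic_mem_nhds (ENNReal.half_pos hη.ne'))] with n hn
    calc _ ≤ _ := hC n
      _ ≤ η / 2 + η / 2 := add_le_add hεK hn
      _ = η := ENNReal.add_halves η
  refine ⟨fun n => ⟨hmeas n, ?_⟩, ?_⟩
  · rw [hasFiniteIntegral_iff_ofReal (Eventually.of_forall fun x => hΨnonneg _)]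
    exact hfin n
  · have := (ENNReal.tendsto_toReal ENNReal.zero_ne_top).comp hlim
    rw [ENNReal.toReal_zero] at this
    refine this.congr fun n => ?_
    rw [integral_eq_lintegral_of_nonneg_ae (Eventually.of_forall fun x => hΨnonneg _) (hmeas n)]
    rfl
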